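/- Let $N\ge 1$, let $\Omega\subset\mathbb R^N$ be a bounded open set, let $p>1$ and $p'=\frac{p}{p-1}$. Let $W_0^{1,p}(\Omega)$ be the closure of $C_c^\infty(\Omega)$ in $W^{1,p}(\Omega)$. A real number $\lambda$ is an eigenvalue of the $p$-Laplacian if there is a nonzero $u\in W^{1,p}_0(\Omega)$ with $-\mathrm{div}(|\nabla u|^{p-2}\nabla u)=\lambda|u|^{p-2}u$ in $\Omega$ in the sense of distributions; such a $u$ is called an eigenfunction for $\lambda$. Let $\lambda_p$ be the first (smallest) eigenvalue, let $u_p$ be an eigenfunction for $\lambda_p$ with $u_p>0$ a.e. in $\Omega$ and $\int_\Omega u_p^p\,dx=1$, and put $f_p:=u_p^{p-1}$. Consider $$(\mathcal P_p)\qquad \min_{v\in W^{1,p}_0(\Omega)}\Big\{\frac1{p\lambda_p}\int_\Omega|\nabla v|^p\,dx-\int_\Omega f_p v\,dx\Big\},$$ $$(\mathcal P_p^*)\qquad \min_{\sigma\in L^{p'}(\mathbb R^N;\mathbb R^N)}\Big\{\frac1{p'}\lambda_p^{p'-1}\int_{\overline\Omega}|\sigma|^{p'}dx:\ \mathrm{spt}(\sigma)\subset\overline\Omega,\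 -\mathrm{div}\,\sigma\in\mathcal M_b(\mathbb R^N),\ -\mathrm{div}\,\sigma=f_p\text{ in }\Omega\Big\},$$ where $\mathcal M_b(\mathbb R^N)$ is the set of finite signed Borel measures and the conditions on $-\mathrm{div}\,\sigma$ are in the sense of distributions, on $\mathbb R^N$ and in $\Omega$ respectively. Then both minima are attained, and $$\min(\mathcal P_p)=-\min(\mathcal P_p^*).$$ -/

import Mathlib

open MeasureTheory Filter Topology
open scoped ContDiff

noncomputable section

namespace PLaplace

/-- `ℝ^N` with its Euclidean structure. -/
abbrev Euc (N : ℕ) : Type := EuclideanSpace ℝ (Fin N)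

variable {N : ℕ}

/-- `φ ∈ C_c^∞(Ω)`: smooth, with compact support contained in `Ω`. -/
structure IsTest (Ω : Set (Euc N)) (φ : Euc N → ℝ) : Prop where
  smooth : ContDiff ℝ ∞ φ
  compact : HasCompactSupport φ
  supp : tsupport φ ⊆ Ω

/-- `v ∈ W^{1,p}(Ω)` with weak gradient `G`. -/
structure MemW (Ω : Set (Euc N)) (p : ℝ) (v : Euc N → ℝ) (G : Euc N → Euc N) : Prop where
  memLp : MemLp v (ENNReal.ofReal p) (volume.restrict Ω)
  memLp_grad : MemLp G (ENNReal.ofReal p) (volume.restrict Ω)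
  weakGrad : ∀ φ : Euc N → ℝ, IsTest Ω φ → ∀ e : Euc N,
    ∫ x in Ω, v x * inner ℝ (gradient φ x) e = -∫ x in Ω, φ x * inner ℝ (G x) e

/-- `v ∈ W_0^{1,p}(Ω)` with weak gradient `G`: `v` belongs to the closure of `C_c^∞(Ω)` in
`W^{1,p}(Ω)`. -/
structure MemWZero (Ω : Set (Euc N)) (p : ℝ) (v : Euc N → ℝ) (G : Euc N → Euc N) : Prop
    extends MemW Ω p v G where
  approx : ∃ φ : ℕ → Euc N → ℝ, (∀ n, IsTest Ω (φ n)) ∧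
    Tendsto (fun n => eLpNorm (fun x => v x - φ n x) (ENNReal.ofReal p) (volume.restrict Ω))
      atTop (𝓝 0) ∧
    Tendsto (fun n => eLpNorm (fun x => G x - gradient (φ n) x) (ENNReal.ofReal p)
      (volume.restrict Ω)) atTop (𝓝 0)

/-- `u` (with weak gradient `G`) is an eigenfunction of the `p`-Laplacian for `lam`: a nonzero
element of `W_0^{1,p}(Ω)` with `-div (|∇u|^{p-2} ∇u) = lam |u|^{p-2} u` in the sense of
distributions in `Ω`. -/
structure IsEigenfunction (Ω : Set (Euc N)) (p lam : ℝ) (u : Euc N → ℝ) (G : Euc N → Euc N) :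
    Prop where
  mem : MemWZero Ω p u G
  nonzero : ¬ (u =ᵐ[volume.restrict Ω] 0)
  weakEq : ∀ φ : Euc N → ℝ, IsTest Ω φ →
    ∫ x in Ω, ‖G x‖ ^ (p - 2) * inner ℝ (G x) (gradient φ x) =
      lam * ∫ x in Ω, |u x| ^ (p - 2) * u x * φ x

/-- `lam` is an eigenvalue of the `p`-Laplacian in `Ω` with zero boundary values. -/
def IsEigenvalue (Ω : Set (Euc N)) (p lam : ℝ) : Prop :=
  ∃ (u : Euc N → ℝ) (G : Euc N → Euc N), IsEigenfunction Ω p lam u G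

/-- The first (smallest) eigenvalue `λ_p` of the `p`-Laplacian in `Ω`. -/
def firstEigenvalue (Ω : Set (Euc N)) (p : ℝ) : ℝ :=
  sInf {lam : ℝ | IsEigenvalue Ω p lam}

/-- `u` is a first eigenfunction `u_p`: it is positive in `Ω` and satisfies `‖u‖_{L^p(Ω)} = 1`. -/
def IsFirstEigenfunction (Ω : Set (Euc N)) (p : ℝ) (u : Euc N → ℝ) : Prop :=
  (∃ G : Euc N → Euc N, IsEigenfunction Ω p (firstEigenvalue Ω p) u G) ∧
  (∀ᵐ x ∂(volume.restrict Ω), 0 < u x) ∧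
  ∫ x in Ω, u x ^ p = 1

/-- The values of the primal problem: `(1 / (p λ_p)) ∫_Ω |∇v|^p - ∫_Ω f v` for
`v ∈ W_0^{1,p}(Ω)`. -/
def primalValues (Ω : Set (Euc N)) (p : ℝ) (f : Euc N → ℝ) : Set ℝ :=
  {t | ∃ (v : Euc N → ℝ) (G : Euc N → Euc N), MemWZero Ω p v G ∧
    t = 1 / (p * firstEigenvalue Ω p) * (∫ x in Ω, ‖G x‖ ^ p) - ∫ x in Ω, f x * v x}

/-- `-div σ` is a finite signed Borel measure on `ℝ^N`, written as a difference `μ - ν` of two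
finite positive measures, in the sense of distributions. -/
def NegDivIsFiniteMeasure (σ : Euc N → Euc N) : Prop :=
  ∃ μ ν : Measure (Euc N), IsFiniteMeasure μ ∧ IsFiniteMeasure ν ∧
    ∀ φ : Euc N → ℝ, IsTest Set.univ φ →
      ∫ x, inner ℝ (gradient φ x) (σ x) = (∫ x, φ x ∂μ) - ∫ x, φ x ∂ν

/-- `-div σ = f` in `Ω`, in the sense of distributions. -/
def NegDivEq (Ω : Set (Euc N)) (σ : Euc N → Euc N) (f : Euc N → ℝ) : Prop :=
  ∀ φ : Euc N → ℝ, IsTest Ω φ →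
    ∫ x, inner ℝ (gradient φ x) (σ x) = ∫ x in Ω, φ x * f x

/-- Admissible fields of the dual problem; `q` is the exponent conjugate to `p`. -/
structure IsAdmissible (Ω : Set (Euc N)) (q : ℝ) (f : Euc N → ℝ) (σ : Euc N → Euc N) :
    Prop where
  memLp : MemLp σ (ENNReal.ofReal q) volume
  supp : ∀ᵐ x ∂(volume : Measure (Euc N)), x ∉ closure Ω → σ x = 0
  divMeasure : NegDivIsFiniteMeasure σ
  divEq : NegDivEq Ω σ f

/-- The values of the dual problem: `(1/p') λ_p^{p'-1} ∫_{closure Ω} |σ|^{p'}` over all admissible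
fields, with `p' = p / (p - 1)`. -/
def dualValues (Ω : Set (Euc N)) (p : ℝ) (f : Euc N → ℝ) : Set ℝ :=
  {t | ∃ σ : Euc N → Euc N, IsAdmissible Ω (p / (p - 1)) f σ ∧
    t = 1 / (p / (p - 1)) * firstEigenvalue Ω p ^ (p / (p - 1) - 1) *
      ∫ x in closure Ω, ‖σ x‖ ^ (p / (p - 1))}

end PLaplace

end

/-! ### Test functions, and positive functionals as finite measures -/

section

namespace PLaplace

variable {N : ℕ} {Ω : Set (Euc N)} {φ ψ : Euc N → ℝ}

/-! Both minimizers are explicit: `u` itself, and the flux `σ = λ⁻¹|∇u|^{p-2}∇u` extended by zero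
(`dualField`). Testing the equation with `u` gives `∫|∇u|^p = λ`, so the two energies are `1/p - 1`
and its negative. Weak duality (`neg_dual_le_primal`), which is Young's inequality after testing
`-div σ = f` with `v`, then makes both optimal.

The real work is that `-div σ` is a finite measure on the whole space, across `∂Ω`, with no boundary
regularity. Since `u > 0`, its extension by zero is a subsolution (`integral_inner_flux_le`): test
with `φ arctan(k u)`, drop a nonnegative term, let `k → ∞`. Hence `f + div σ` is a positive
functional on test functions, and `exists_finite_measure_of_nonneg` represents it by a finite
measure `ν`, so `-div σ = f dx - ν`.

Dividing by `λ` requires `λ > 0` (`eigenvalue_pos`). -/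

theorem gradient_eq_toDual_symm (f : Euc N → ℝ) (x : Euc N) :
    gradient f x = (InnerProductSpace.toDual ℝ (Euc N)).symm (fderiv ℝ f x) := rfl

theorem gradient_add_of_differentiable {f g : Euc N → ℝ} (hf : Differentiable ℝ f)
    (hg : Differentiable ℝ g) (x : Euc N) :
    gradient (f + g) x = gradient f x + gradient g x := by
  simp [gradient_eq_toDual_symm, fderiv_add (hf x) (hg x)]

theorem gradient_smul_of_differentiable {f : Euc N → ℝ} (c : ℝ) (hf : Differentiable ℝ f)
    (x : Euc N) : gradient (c • f) x = c • gradient f x := by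
  simp [gradient_eq_toDual_symm, fderiv_const_smul (hf x)]

theorem gradient_mul_comp {f g : Euc N → ℝ} {H : ℝ → ℝ} (hf : Differentiable ℝ f)
    (hg : Differentiable ℝ g) (hH : Differentiable ℝ H) (x : Euc N) :
    gradient (fun y => f y * H (g y)) x =
      H (g x) • gradient f x + (f x * deriv H (g x)) • gradient g x := by
  have h1 : HasFDerivAt (fun y => H (g y)) (deriv H (g x) • fderiv ℝ g x) x :=
    (hH (g x)).hasDerivAt.comp_hasFDerivAt x (hg x).hasFDerivAt
  have h2 := (hf x).hasFDerivAt.mul h1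
  rw [gradient_eq_toDual_symm, gradient_eq_toDual_symm, gradient_eq_toDual_symm,
    show fderiv ℝ (fun y => f y * H (g y)) x = _ from h2.fderiv]
  simp [add_comm, smul_smul]

namespace IsTest

theorem differentiable (h : IsTest Ω φ) : Differentiable ℝ φ :=
  h.smooth.differentiable (by simp)

theorem continuous_gradient (h : IsTest Ω φ) : Continuous (gradient φ) :=
  (InnerProductSpace.toDual ℝ (Euc N)).symm.continuous.comp (h.smooth.continuous_fderiv (by simp))

theorem hasCompactSupport_gradient (h : IsTest Ω φ) : HasCompactSupport (gradient φ) :=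
  (h.compact.fderiv ℝ).comp_left (g := (InnerProductSpace.toDual ℝ (Euc N)).symm) (map_zero _)

theorem memLp (h : IsTest Ω φ) (q : ENNReal) (μ : Measure (Euc N)) [IsFiniteMeasureOnCompacts μ] :
    MemLp φ q μ :=
  h.smooth.continuous.memLp_of_hasCompactSupport h.compact

theorem memLp_gradient (h : IsTest Ω φ) (q : ENNReal) (μ : Measure (Euc N))
    [IsFiniteMeasureOnCompacts μ] : MemLp (gradient φ) q μ :=
  h.continuous_gradient.memLp_of_hasCompactSupport h.hasCompactSupport_gradient

theorem eq_zero_of_notMem (h : IsTest Ω φ) {x : Euc N} (hx : x ∉ Ω) : φ x = 0 :=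
  image_eq_zero_of_notMem_tsupport fun hx' => hx (h.supp hx')

theorem gradient_eq_zero_of_notMem (h : IsTest Ω φ) {x : Euc N} (hx : x ∉ Ω) :
    gradient φ x = 0 := by
  have : fderiv ℝ φ x = 0 := by
    by_contra h0
    exact hx (h.supp (support_fderiv_subset ℝ h0))
  simp [gradient_eq_toDual_symm, this]

theorem exists_bound (h : IsTest Ω φ) : ∃ C, ∀ x, ‖φ x‖ ≤ C :=
  h.smooth.continuous.bounded_above_of_compact_support h.compact

theorem exists_bound_gradient (h : IsTest Ω φ) : ∃ C, ∀ x, ‖gradient φ x‖ ≤ C :=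
  h.continuous_gradient.bounded_above_of_compact_support h.hasCompactSupport_gradient

/-- As `H 0 = 0`, the factor `H ∘ ψ` alone confines the support to `Ω`; this lets `φ` be nonzero on
`∂Ω`. -/
theorem mul_comp (hφ : IsTest Set.univ φ) (hψ : IsTest Ω ψ) {H : ℝ → ℝ} (hH : ContDiff ℝ ∞ H)
    (h0 : H 0 = 0) : IsTest Ω (fun x => φ x * H (ψ x)) := by
  refine ⟨hφ.smooth.mul (hH.comp hψ.smooth), (hψ.compact.comp_left h0).mul_left, ?_⟩
  refine (tsupport_mul_subset_right (f := φ) (g := fun x => H (ψ x))).trans (subset_trans ?_ hψ.supp)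
  refine closure_mono fun x hx => ?_
  intro h
  simp only [Function.mem_support, ne_eq] at hx
  exact hx (by rw [h, h0])

end IsTest

/-- A smooth cutoff which equals one on a given ball. -/
theorem exists_cutoff (N : ℕ) (R : ℝ) : ∃ χ : Euc N → ℝ, IsTest Set.univ χ ∧
    (∀ x, 0 ≤ χ x) ∧ (∀ x, χ x ≤ 1) ∧ ∀ x, ‖x‖ ≤ R → χ x = 1 := by
  let b : ContDiffBump (0 : Euc N) := ⟨|R| + 1, |R| + 2, by positivity, by linarith⟩
  refine ⟨b, ⟨b.contDiff, b.hasCompactSupport, Set.subset_univ _⟩, fun x => b.nonneg,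
    fun x => b.le_one, fun x hx => b.one_of_mem_closedBall ?_⟩
  rw [mem_closedBall_zero_iff]
  exact hx.trans ((le_abs_self R).trans (by change |R| ≤ |R| + 1; linarith))

open CompactlySupported in
/-- A linear functional on test functions which is nonnegative on functions that are nonnegative
on a bounded set is integration against a finite measure. -/
theorem exists_finite_measure_of_nonneg (hbdd : Bornology.IsBounded Ω)
    (T : (Euc N → ℝ) → ℝ)
    (hadd : ∀ φ ψ, IsTest Set.univ φ → IsTest Set.univ ψ → T (φ + ψ) = T φ + T ψ)
    (hsmul : ∀ (c : ℝ) φ, IsTest Set.univ φ → T (c • φ) = c * T φ)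
    (hnonneg : ∀ φ, IsTest Set.univ φ → (∀ x ∈ Ω, 0 ≤ φ x) → 0 ≤ T φ) :
    ∃ ν : Measure (Euc N), IsFiniteMeasure ν ∧ ∀ φ, IsTest Set.univ φ → ∫ x, φ x ∂ν = T φ := by
  let S : Submodule ℝ C_c(Euc N, ℝ) :=
    { carrier := {f | ContDiff ℝ ∞ f}
      add_mem' := fun {f g} hf hg => by
        simp only [Set.mem_ofPred_eq] at hf hg ⊢
        exact hf.add hg
      zero_mem' := (contDiff_const : ContDiff ℝ ∞ fun _ : Euc N => (0 : ℝ))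
      smul_mem' := fun c f hf => by
        simp only [Set.mem_ofPred_eq] at hf ⊢
        exact hf.const_smul c }
  have htest : ∀ f : S, IsTest Set.univ (f : C_c(Euc N, ℝ)) := fun f =>
    ⟨f.2, f.1.hasCompactSupport, Set.subset_univ _⟩
  let T' : C_c(Euc N, ℝ) →ₗ.[ℝ] ℝ :=
    { domain := S
      toFun :=
        { toFun := fun f => T (f : C_c(Euc N, ℝ))
          map_add' := fun f g => hadd _ _ (htest f) (htest g)
          map_smul' := fun c f => hsmul c _ (htest f) } }
  -- Positivity is required on `Ω` only. As `χ = 1` there, adding a large multiple of `χ` pushes any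
  -- function into this cone, which is the hypothesis of the M. Riesz extension theorem.
  let s : PointedCone ℝ C_c(Euc N, ℝ) :=
    { carrier := {f | ∀ x ∈ Ω, 0 ≤ f x}
      add_mem' := fun {f g} hf hg x hx => add_nonneg (hf x hx) (hg x hx)
      zero_mem' := fun x _ => le_rfl
      smul_mem' := fun c f hf x hx => mul_nonneg c.2 (hf x hx) }
  obtain ⟨R, hR⟩ := hbdd.exists_norm_le
  obtain ⟨χ, hχ, -, -, hχR⟩ := exists_cutoff N R
  have hχΩ : ∀ x ∈ Ω, χ x = 1 := fun x hx => hχR x (hR x hx)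
  let χc : S := ⟨⟨⟨χ, hχ.smooth.continuous⟩, hχ.compact⟩, hχ.smooth⟩
  obtain ⟨g, hg, hgs⟩ := riesz_extension s T' (fun f hf => hnonneg _ (htest f) hf) (by
    intro y
    obtain ⟨C, hC⟩ := y.continuous.bounded_above_of_compact_support y.hasCompactSupport
    refine ⟨C • χc, fun x hx => ?_⟩
    change 0 ≤ C * χ x + y x
    rw [hχΩ x hx]
    have : -C ≤ y x := (abs_le.1 (hC x)).1
    linarith)
  let Λ : C_c(Euc N, ℝ) →ₚ[ℝ] ℝ := PositiveLinearMap.mk₀ g fun f hf => hgs f fun x _ => hf x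
  refine ⟨RealRMK.rieszMeasure Λ, ⟨?_⟩, fun φ hφ => ?_⟩
  -- The bound does not depend on `n`: on `Ω`, every cutoff `η ≤ 1 = χ`, so `χ - η` lies in the cone
  -- even if `η` exceeds `χ` elsewhere.
  · have hball : ∀ n : ℕ, RealRMK.rieszMeasure Λ (Metric.closedBall 0 n) ≤
        ENNReal.ofReal (g χc) := by
      intro n
      obtain ⟨η, hη, hη0, hη1, hηn⟩ := exists_cutoff N n
      let ηc : C_c(Euc N, ℝ) := ⟨⟨η, hη.smooth.continuous⟩, hη.compact⟩
      refine (RealRMK.rieszMeasure_le_of_eq_one Λ (f := ηc) hη0 (isCompact_closedBall _ _)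
        fun x hx => hηn x (mem_closedBall_zero_iff.1 hx)).trans (ENNReal.ofReal_le_ofReal ?_)
      have h := hgs ((χc : C_c(Euc N, ℝ)) - ηc) fun x hx => by
        change 0 ≤ χ x - η x
        rw [hχΩ x hx]
        linarith [hη1 x]
      rw [map_sub] at h
      change g ηc ≤ _
      linarith
    have hU : (⋃ n : ℕ, Metric.closedBall (0 : Euc N) n) = Set.univ :=
      Metric.iUnion_closedBall_nat 0
    rw [← hU, Directed.measure_iUnion (Monotone.directed_le fun m n hmn =>
      Metric.closedBall_subset_closedBall (by exact_mod_cast hmn))]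
    exact (iSup_le hball).trans_lt ENNReal.ofReal_lt_top
  · let φc : S := ⟨⟨⟨φ, hφ.smooth.continuous⟩, hφ.compact⟩, hφ.smooth⟩
    rw [← show g φc = T φ from hg φc]
    exact RealRMK.integral_rieszMeasure Λ (φc : C_c(Euc N, ℝ))

end PLaplace

end

/-! ### Hölder pairings, the flux, and positivity of the eigenvalue -/

section

namespace PLaplace

variable {N : ℕ} {Ω : Set (Euc N)}

section Hoelder

variable {α E : Type*} [MeasurableSpace α] {μ : Measure α} [NormedAddCommGroup E]
  [InnerProductSpace ℝ E] {F g : α → E}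

theorem integrable_inner_of_memLp {p q : ENNReal} [p.HolderConjugate q] (hF : MemLp F p μ)
    (hg : MemLp g q μ) : Integrable (fun x => inner ℝ (F x) (g x)) μ :=
  memLp_one_iff_integrable.1 <| MemLp.of_bilin (fun a b : E => inner ℝ a b) 1 hF hg
    (hF.1.inner hg.1) (.of_forall fun x => by simpa using nnnorm_inner_le_nnnorm (F x) (g x))

theorem eLpNorm_one_inner_le {p q : ENNReal} [p.HolderConjugate q] (hF : MemLp F p μ)
    (hg : AEStronglyMeasurable g μ) :
    eLpNorm (fun x => inner ℝ (F x) (g x)) 1 μ ≤ eLpNorm F p μ * eLpNorm g q μ := by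
  simpa using eLpNorm_le_eLpNorm_mul_eLpNorm_of_nnnorm (r := 1) (p := p) (q := q) hF.1 hg
    (fun a b : E => inner ℝ a b) 1
    (.of_forall fun x => by simpa using nnnorm_inner_le_nnnorm (F x) (g x))

theorem tendsto_integral_inner {p q : ENNReal} [p.HolderConjugate q] (hF : MemLp F p μ)
    {k : ℕ → α → E} (hg : MemLp g q μ) (hk : ∀ n, MemLp (k n) q μ)
    (hlim : Tendsto (fun n => eLpNorm (fun x => g x - k n x) q μ) atTop (𝓝 0)) :
    Tendsto (fun n => ∫ x, inner ℝ (F x) (k n x) ∂μ) atTop (𝓝 (∫ x, inner ℝ (F x) (g x) ∂μ)) := by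
  have h0 : Tendsto (fun n => eLpNorm F p μ * eLpNorm (fun x => g x - k n x) q μ) atTop (𝓝 0) := by
    simpa using ENNReal.Tendsto.const_mul hlim (.inr hF.2.ne)
  have h1 : ∀ n, eLpNorm ((fun x => inner ℝ (F x) (k n x)) - fun x => inner ℝ (F x) (g x)) 1 μ ≤
      eLpNorm F p μ * eLpNorm (fun x => g x - k n x) q μ := fun n => by
    have h : AEStronglyMeasurable (fun x => g x - k n x) μ := hg.1.sub (hk n).1
    rw [eLpNorm_sub_comm]
    refine (congrArg (fun f => eLpNorm f 1 μ) ?_).trans_le (eLpNorm_one_inner_le (q := q) hF h)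
    exact funext fun x => (inner_sub_right _ _ _).symm
  exact tendsto_integral_of_L1' _ (hF.1.inner hg.1)
    (.of_forall fun n => integrable_inner_of_memLp hF (hk n))
    (tendsto_of_tendsto_of_tendsto_of_le_of_le tendsto_const_nhds h0 (fun n => zero_le) h1)

end Hoelder

section Flux

variable {E : Type*} [NormedAddCommGroup E] {p : ℝ}

theorem integrable_norm_rpow_of_memLp {α : Type*} [MeasurableSpace α] {μ : Measure α} {G : α → E}
    (hp : 0 < p) (hG : MemLp G (ENNReal.ofReal p) μ) : Integrable (fun x => ‖G x‖ ^ p) μ := by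
  have h := hG.integrable_norm_rpow (by simpa using hp) ENNReal.ofReal_ne_top
  rwa [ENNReal.toReal_ofReal hp.le] at h

variable [InnerProductSpace ℝ E]

theorem rpow_sub_two_mul_self {t : ℝ} (hp : 1 < p) (ht : 0 ≤ t) : t ^ (p - 2) * t = t ^ (p - 1) := by
  rcases ht.eq_or_lt with rfl | ht
  · rw [mul_zero, Real.zero_rpow (by linarith)]
  · nth_rw 2 [← Real.rpow_one t]
    rw [← Real.rpow_add ht]
    ring_nf

theorem rpow_sub_one_mul_self {t : ℝ} (hp : 1 < p) (ht : 0 ≤ t) : t ^ (p - 1) * t = t ^ p := by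
  rcases ht.eq_or_lt with rfl | ht
  · rw [mul_zero, Real.zero_rpow (by linarith)]
  · nth_rw 2 [← Real.rpow_one t]
    rw [← Real.rpow_add ht]
    ring_nf

theorem norm_flux (hp : 1 < p) (a : E) : ‖‖a‖ ^ (p - 2) • a‖ = ‖a‖ ^ (p - 1) := by
  rw [norm_smul, Real.norm_of_nonneg (by positivity), rpow_sub_two_mul_self hp (norm_nonneg a)]

theorem norm_flux_rpow (hp : 1 < p) (a : E) :
    ‖‖a‖ ^ (p - 2) • a‖ ^ (p / (p - 1)) = ‖a‖ ^ p := by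
  have : p - 1 ≠ 0 := by linarith
  rw [norm_flux hp, ← Real.rpow_mul (norm_nonneg a)]
  congr 1
  field_simp

theorem inner_flux_self (hp : 1 < p) (a : E) : inner ℝ (‖a‖ ^ (p - 2) • a) a = ‖a‖ ^ p := by
  rw [real_inner_smul_left, real_inner_self_eq_norm_sq, pow_two, ← mul_assoc,
    rpow_sub_two_mul_self hp (norm_nonneg a), rpow_sub_one_mul_self hp (norm_nonneg a)]

/-- The norm of the flux is `‖G‖^(p-1)`. A general `E` covers both the gradient and, with `E = ℝ`,
the right-hand side `|u|^{p-2}u`. -/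
theorem memLp_flux {α : Type*} [MeasurableSpace α] {μ : Measure α} {G : α → E} (hp : 1 < p)
    (hG : MemLp G (ENNReal.ofReal p) μ) :
    MemLp (fun x => ‖G x‖ ^ (p - 2) • G x) (ENNReal.ofReal (p / (p - 1))) μ := by
  have h := hG.norm_rpow_div (ENNReal.ofReal (p - 1))
  rw [ENNReal.toReal_ofReal (by linarith), ← ENNReal.ofReal_div_of_pos (by linarith)] at h
  refine h.of_le ?_ (.of_forall fun x => ?_)
  · exact ((hG.1.norm.aemeasurable.pow_const _).aestronglyMeasurable).smul hG.1
  · rw [norm_flux hp]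
    exact le_abs_self _

end Flux

variable {p : ℝ}

theorem holderConjugate_conj (hp : 1 < p) :
    (ENNReal.ofReal (p / (p - 1))).HolderConjugate (ENNReal.ofReal p) :=
  (Real.HolderConjugate.conjExponent hp).symm.ennrealOfReal

/-- A weak divergence identity can be tested with elements of `W_0^{1,p}(Ω)`. -/
theorem MemWZero.integral_inner_eq {v : Euc N → ℝ} {G F : Euc N → Euc N} {f : Euc N → ℝ}
    (hp : 1 < p) (hv : MemWZero Ω p v G)
    (hF : MemLp F (ENNReal.ofReal (p / (p - 1))) (volume.restrict Ω))
    (hf : MemLp f (ENNReal.ofReal (p / (p - 1))) (volume.restrict Ω))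
    (h : ∀ φ, IsTest Ω φ → ∫ x in Ω, inner ℝ (F x) (gradient φ x) = ∫ x in Ω, f x * φ x) :
    ∫ x in Ω, inner ℝ (F x) (G x) = ∫ x in Ω, f x * v x := by
  have := holderConjugate_conj hp
  obtain ⟨φ, hφ, hφv, hφG⟩ := hv.approx
  have h1 := tendsto_integral_inner hF hv.memLp_grad (fun n => (hφ n).memLp_gradient _ _) hφG
  have h2 := tendsto_integral_inner hf hv.memLp (fun n => (hφ n).memLp _ _) hφv
  simp only [RCLike.inner_apply, conj_trivial, mul_comm _ (f _)] at h2
  refine tendsto_nhds_unique h1 (h2.congr fun n => ?_)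
  rw [h _ (hφ n)]

/-- An element of `W_0^{1,p}(Ω)` with vanishing gradient has zero mean. -/
theorem MemWZero.integral_eq_zero {v : Euc N → ℝ} {G : Euc N → Euc N} (hN : 1 ≤ N)
    (hΩ : IsOpen Ω) (hbdd : Bornology.IsBounded Ω) (hp : 1 < p) (hv : MemWZero Ω p v G)
    (hG : G =ᵐ[volume.restrict Ω] 0) : ∫ x in Ω, v x = 0 := by
  have hfin : IsFiniteMeasure (volume.restrict Ω) :=
    ⟨by simpa using hbdd.measure_lt_top⟩
  let e : Euc N := EuclideanSpace.single ⟨0, hN⟩ 1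
  have he : ‖e‖ = 1 := by simp [e]
  obtain ⟨R, hR⟩ := hbdd.exists_norm_le
  -- The field `-⟨e, x⟩ e` is bounded on `Ω` and has `-div = 1`, so pairing it with `G` yields `∫
  -- v`.
  have h := hv.integral_inner_eq (F := fun x => (-inner ℝ e x) • e) (f := fun _ => 1) hp
    (MemLp.of_bound (by fun_prop) R (by
      filter_upwards [ae_restrict_mem hΩ.measurableSet] with x hx
      rw [norm_smul, he, mul_one, norm_neg]
      exact (norm_inner_le_norm e x).trans (by rw [he, one_mul]; exact hR x hx)))
    (memLp_const 1) (fun φ hφ => by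
      have h0 : ∀ x, fderiv ℝ φ x e = inner ℝ e (gradient φ x) := fun x => by
        rw [real_inner_comm, inner_gradient_left]
      have hl : ∀ x, fderiv ℝ (fun y => inner ℝ e y) x e = (1 : ℝ) := fun x => by
        rw [show (fun y : Euc N => inner ℝ e y) = innerSL ℝ e from rfl,
          ContinuousLinearMap.fderiv, innerSL_apply_apply, real_inner_self_eq_norm_sq, he, one_pow]
      have hc := hφ.continuous_gradient
      have hφc := hφ.smooth.continuous
      have key := integral_mul_fderiv_eq_neg_fderiv_mul_of_integrable (μ := volume)
        (f := fun y => inner ℝ e y) (g := φ) (v := e)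
        (by
          simp only [hl, one_mul]
          exact hφc.integrable_of_hasCompactSupport hφ.compact)
        (by
          simp only [h0]
          refine Continuous.integrable_of_hasCompactSupport (by fun_prop) ?_
          exact HasCompactSupport.mul_left
            (hφ.hasCompactSupport_gradient.comp_left (g := fun a => inner ℝ e a)
              (inner_zero_right e)))
        (Continuous.integrable_of_hasCompactSupport (by fun_prop) hφ.compact.mul_left)
        (fun x _ => (innerSL ℝ e).differentiableAt) (fun x _ => hφ.differentiable x)
      simp only [hl, h0, one_mul] at key
      rw [setIntegral_eq_integral_of_forall_compl_eq_zero (fun x hx => by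
          rw [hφ.gradient_eq_zero_of_notMem hx, inner_zero_right]),
        setIntegral_eq_integral_of_forall_compl_eq_zero (fun x hx => by
          rw [hφ.eq_zero_of_notMem hx, mul_zero])]
      simp only [one_mul, real_inner_smul_left, neg_mul, integral_neg, key, neg_neg])
  simp only [one_mul] at h
  rw [← h]
  refine integral_eq_zero_of_ae ?_
  filter_upwards [hG] with x hx
  simp [hx]

namespace IsEigenfunction

variable {lam : ℝ} {u : Euc N → ℝ} {G : Euc N → Euc N}

/-- The weak equation extends by density to the test function `u`. -/
theorem integral_norm_rpow (hp : 1 < p) (h : IsEigenfunction Ω p lam u G) :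
    ∫ x in Ω, ‖G x‖ ^ p = lam * ∫ x in Ω, |u x| ^ p := by
  have key := h.mem.integral_inner_eq hp (memLp_flux hp h.mem.memLp_grad)
    ((memLp_flux hp h.mem.memLp).const_mul lam) (fun φ hφ => by
      have := h.weakEq φ hφ
      rw [← integral_const_mul] at this
      simpa only [real_inner_smul_left, Real.norm_eq_abs, smul_eq_mul, mul_assoc] using this)
  simp only [inner_flux_self hp] at key
  rw [key, ← integral_const_mul]
  refine integral_congr_ae (.of_forall fun x => ?_)
  have := inner_flux_self hp (u x)
  rw [RCLike.inner_apply, conj_trivial, Real.norm_eq_abs] at this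
  simp only [Real.norm_eq_abs]
  rw [mul_assoc, mul_comm _ (u x), this]

/-- The energy identity gives `lam ≥ 0`. If `lam = 0`, the gradient vanishes, so `u` has zero mean,
which contradicts its positivity. -/
theorem eigenvalue_pos (hN : 1 ≤ N) (hΩ : IsOpen Ω) (hbdd : Bornology.IsBounded Ω) (hp : 1 < p)
    (h : IsEigenfunction Ω p lam u G) (hpos : ∀ᵐ x ∂(volume.restrict Ω), 0 < u x)
    (hnorm : ∫ x in Ω, u x ^ p = 1) : 0 < lam := by
  have h1 : ∫ x in Ω, |u x| ^ p = 1 := by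
    rw [← hnorm]
    refine integral_congr_ae ?_
    filter_upwards [hpos] with x hx
    rw [abs_of_pos hx]
  have hlam := h.integral_norm_rpow hp
  rw [h1, mul_one] at hlam
  have h0 : 0 ≤ lam := hlam ▸ integral_nonneg fun x => by positivity
  refine h0.lt_of_ne' fun h00 => ?_
  rw [h00, integral_eq_zero_iff_of_nonneg (fun x => by positivity)
    (integrable_norm_rpow_of_memLp (by linarith) h.mem.memLp_grad)] at hlam
  have hG : G =ᵐ[volume.restrict Ω] 0 := by
    filter_upwards [hlam] with x hx
    simpa using ((Real.rpow_eq_zero_iff_of_nonneg (norm_nonneg _)).1 hx).1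
  have hu := h.mem.integral_eq_zero hN hΩ hbdd hp hG
  have : IsFiniteMeasure (volume.restrict Ω) := ⟨by simpa using hbdd.measure_lt_top⟩
  have hint : Integrable u (volume.restrict Ω) :=
    h.mem.memLp.integrable (by simpa using hp.le)
  rw [integral_eq_zero_iff_of_nonneg_ae (hpos.mono fun x hx => hx.le) hint] at hu
  exact h.nonzero hu

end IsEigenfunction

end PLaplace

end

/-! ### The subsolution inequality across the boundary -/

section

namespace PLaplace

variable {N : ℕ} {Ω : Set (Euc N)} {p : ℝ}

theorem tendsto_integral_mul_of_bounded {α : Type*} [MeasurableSpace α] {μ : Measure α}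
    {w : α → ℝ} (hw : Integrable w μ) {b : ℕ → α → ℝ} {b' : α → ℝ} {C : ℝ}
    (hb : ∀ n, AEStronglyMeasurable (b n) μ) (hC : ∀ n x, ‖b n x‖ ≤ C)
    (hlim : ∀ᵐ x ∂μ, Tendsto (fun n => b n x) atTop (𝓝 (b' x))) :
    Tendsto (fun n => ∫ x, b n x * w x ∂μ) atTop (𝓝 (∫ x, b' x * w x ∂μ)) := by
  refine tendsto_integral_of_dominated_convergence (fun x => C * ‖w x‖)
    (fun n => (hb n).mul hw.1) (hw.norm.const_mul C) (fun n => .of_forall fun x => ?_) ?_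
  · rw [norm_mul]
    exact mul_le_mul_of_nonneg_right (hC n x) (norm_nonneg _)
  · filter_upwards [hlim] with x hx
    exact hx.mul_const _

namespace IsEigenfunction

variable {lam : ℝ} {u : Euc N → ℝ} {G : Euc N → Euc N} {φ : Euc N → ℝ}

/-- The weak equation tested with `φ H(u)`, where `φ` need not vanish on the boundary of `Ω`. -/
theorem integral_comp_eq (hp : 1 < p) (h : IsEigenfunction Ω p lam u G)
    (hφ : IsTest Set.univ φ) {H : ℝ → ℝ} {C : ℝ} (hH : ContDiff ℝ ∞ H) (h0 : H 0 = 0)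
    (hC : ∀ t, ‖H t‖ ≤ C) (hC' : ∀ t, ‖deriv H t‖ ≤ C) :
    (∫ x in Ω, H (u x) * inner ℝ (‖G x‖ ^ (p - 2) • G x) (gradient φ x)) +
      ∫ x in Ω, deriv H (u x) * (φ x * ‖G x‖ ^ p) =
    lam * ∫ x in Ω, H (u x) * (φ x * (‖u x‖ ^ (p - 2) • u x)) := by
  have := holderConjugate_conj hp
  have hF := memLp_flux hp h.mem.memLp_grad
  have hf := memLp_flux hp h.mem.memLp
  obtain ⟨η, hη, hηu, hηG⟩ := h.mem.approx
  -- An a.e. convergent subsequence is needed to pass to the limit inside `H` and `deriv H` by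
  -- dominated convergence.
  have hmeas : TendstoInMeasure (volume.restrict Ω) η atTop u := by
    refine tendstoInMeasure_of_tendsto_eLpNorm (p := ENNReal.ofReal p)
      (by simpa using (by linarith : 0 < p)) (fun n => ((hη n).memLp (ENNReal.ofReal p) _).1)
      h.mem.memLp.1 (hηu.congr fun n => ?_)
    rw [eLpNorm_sub_comm]
    rfl
  obtain ⟨ns, hns, hae⟩ := hmeas.exists_seq_tendsto_ae
  have hηG' := hηG.comp hns.tendsto_atTop
  have hHc := hH.continuous
  have hH'c : Continuous (deriv H) := hH.continuous_deriv (by simp)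
  have hηc : ∀ n, Continuous (η n) := fun n => (hη n).smooth.continuous
  have hφc := hφ.smooth.continuous
  obtain ⟨D, hD⟩ := hφ.exists_bound
  have hφp := hφ.memLp (ENNReal.ofReal p) (volume.restrict Ω)
  have hA := tendsto_integral_mul_of_bounded
    (integrable_inner_of_memLp hF (hφ.memLp_gradient (ENNReal.ofReal p) (volume.restrict Ω)))
    (b := fun n x => H (η (ns n) x)) (b' := fun x => H (u x)) (C := C)
    (fun n => (hHc.comp (hηc _)).aestronglyMeasurable) (fun n x => hC _)
    (hae.mono fun x hx => (hHc.tendsto _).comp hx)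
  have hGp := integrable_norm_rpow_of_memLp (by linarith) h.mem.memLp_grad
  have hB := tendsto_integral_mul_of_bounded (w := fun x => φ x * ‖G x‖ ^ p)
    (hGp.bdd_mul hφc.aestronglyMeasurable (.of_forall hD))
    (b := fun n x => deriv H (η (ns n) x)) (b' := fun x => deriv H (u x)) (C := C)
    (fun n => (hH'c.comp (hηc _)).aestronglyMeasurable) (fun n x => hC' _)
    (hae.mono fun x hx => (hH'c.tendsto _).comp hx)
  have hD' := tendsto_integral_mul_of_bounded
    (w := fun x => φ x * (‖u x‖ ^ (p - 2) • u x))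
    (by simpa only [RCLike.inner_apply, conj_trivial] using integrable_inner_of_memLp hf hφp)
    (b := fun n x => H (η (ns n) x)) (b' := fun x => H (u x)) (C := C)
    (fun n => (hHc.comp (hηc _)).aestronglyMeasurable) (fun n x => hC _)
    (hae.mono fun x hx => (hHc.tendsto _).comp hx)
  have hgm : ∀ n, MemLp (fun x => gradient (η n) x - G x) (ENNReal.ofReal p)
      (volume.restrict Ω) := fun n => ((hη n).memLp_gradient _ _).sub h.mem.memLp_grad
  have hbd : ∀ n x, ‖φ x * deriv H (η n x)‖ ≤ D * C := fun n x => by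
    rw [norm_mul]
    exact mul_le_mul (hD x) (hC' _) (norm_nonneg _) ((norm_nonneg _).trans (hD x))
  have hkb : ∀ n x, ‖(φ x * deriv H (η n x)) • (gradient (η n) x - G x)‖ ≤
      (D * C) * ‖gradient (η n) x - G x‖ := fun n x => by
    rw [norm_smul]
    exact mul_le_mul_of_nonneg_right (hbd n x) (norm_nonneg _)
  have hkm : ∀ n, MemLp (fun x => (φ x * deriv H (η n x)) • (gradient (η n) x - G x))
      (ENNReal.ofReal p) (volume.restrict Ω) := fun n => by
    refine (hgm n).of_le_mul (c := D * C) ?_ (.of_forall (hkb n))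
    exact (hφc.mul (hH'c.comp (hηc n))).aestronglyMeasurable.smul (hgm n).1
  -- In `∇(φ H(η)) = H(η)∇φ + φ H'(η)∇η`, write `∇η = G + (∇η - G)`; the error term vanishes since
  -- its coefficient is bounded.
  have hE := tendsto_integral_inner hF (g := fun _ => 0)
    (k := fun n x => (φ x * deriv H (η (ns n) x)) • (gradient (η (ns n)) x - G x))
    (MemLp.zero' (p := ENNReal.ofReal p)) (fun n => hkm _) (by
      have hlim : Tendsto (fun n => ENNReal.ofReal (D * C) *
          eLpNorm (fun x => G x - gradient (η (ns n)) x) (ENNReal.ofReal p) (volume.restrict Ω))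
          atTop (𝓝 0) := by
        simpa using ENNReal.Tendsto.const_mul hηG' (.inr ENNReal.ofReal_ne_top)
      refine tendsto_of_tendsto_of_tendsto_of_le_of_le tendsto_const_nhds hlim
        (fun n => zero_le) fun n => ?_
      refine eLpNorm_le_mul_eLpNorm_of_ae_le_mul (.of_forall fun x => ?_) _
      rw [zero_sub, norm_neg, norm_sub_rev (G x)]
      exact hkb _ x)
  simp only [inner_zero_right, integral_zero] at hE
  have hsum := (hA.add hB).add hE
  rw [add_zero] at hsum
  refine tendsto_nhds_unique hsum ((hD'.const_mul lam).congr fun n => ?_)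
  have hw := h.weakEq _ (hφ.mul_comp (hη (ns n)) hH h0)
  have hiA : Integrable (fun x => H (η (ns n) x) *
      inner ℝ (‖G x‖ ^ (p - 2) • G x) (gradient φ x)) (volume.restrict Ω) :=
    (integrable_inner_of_memLp hF (hφ.memLp_gradient (ENNReal.ofReal p) _)).bdd_mul
      (hHc.comp (hηc _)).aestronglyMeasurable (.of_forall fun x => hC _)
  have hiB : Integrable (fun x => deriv H (η (ns n) x) * (φ x * ‖G x‖ ^ p))
      (volume.restrict Ω) :=
    (hGp.bdd_mul hφc.aestronglyMeasurable (.of_forall hD)).bdd_mul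
      (hH'c.comp (hηc _)).aestronglyMeasurable (.of_forall fun x => hC' _)
  have hiAB : Integrable (fun x => H (η (ns n) x) *
      inner ℝ (‖G x‖ ^ (p - 2) • G x) (gradient φ x) +
      deriv H (η (ns n) x) * (φ x * ‖G x‖ ^ p)) (volume.restrict Ω) := hiA.add hiB
  rw [← integral_add hiA hiB,
    ← integral_add hiAB (integrable_inner_of_memLp hF (hkm (ns n)))]
  · refine Eq.trans ?_ (hw.symm.trans ?_)
    · congr 1
      refine integral_congr_ae (.of_forall fun x => ?_)
      simp only [Real.norm_eq_abs, smul_eq_mul]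
      ring
    · refine integral_congr_ae (.of_forall fun x => ?_)
      simp only
      rw [gradient_mul_comp hφ.differentiable (hη _).differentiable
        (hH.differentiable (by simp)), ← inner_flux_self hp (G x)]
      simp only [inner_add_right, real_inner_smul_right, inner_sub_right, real_inner_smul_left]
      ring

/-- The extension of a positive eigenfunction by zero is a subsolution on the whole space. -/
theorem integral_inner_flux_le (hp : 1 < p) (h : IsEigenfunction Ω p lam u G)
    (hΩ : IsOpen Ω) (hpos : ∀ᵐ x ∂(volume.restrict Ω), 0 < u x)
    (hφ : IsTest Set.univ φ) (hφ0 : ∀ x ∈ Ω, 0 ≤ φ x) :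
    ∫ x in Ω, inner ℝ (‖G x‖ ^ (p - 2) • G x) (gradient φ x) ≤
      lam * ∫ x in Ω, φ x * (‖u x‖ ^ (p - 2) • u x) := by
  have := holderConjugate_conj hp
  have hF := memLp_flux hp h.mem.memLp_grad
  have hf := memLp_flux hp h.mem.memLp
  have hφp := hφ.memLp (ENNReal.ofReal p) (volume.restrict Ω)
  -- Smooth, bounded, nondecreasing, zero at zero, and tending to `π/2` wherever `t > 0`; the factor
  -- `π/2` cancels at the end.
  let H : ℕ → ℝ → ℝ := fun k t => Real.arctan (k * t)
  have hH : ∀ k, ContDiff ℝ ∞ (H k) := fun k =>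
    Real.contDiff_arctan.comp (contDiff_const.mul contDiff_id)
  have hb : ∀ k t, ‖H k t‖ ≤ Real.pi / 2 := fun k t =>
    abs_le.2 ⟨(Real.neg_pi_div_two_lt_arctan _).le, (Real.arctan_lt_pi_div_two _).le⟩
  have hder : ∀ k t, deriv (H k) t = 1 / (1 + (k * t) ^ 2) * k := fun k t => by
    have h1 : HasDerivAt (fun t : ℝ => (k : ℝ) * t) k t := by
      simpa using (hasDerivAt_id t).const_mul (k : ℝ)
    exact h1.arctan.deriv
  have hder0 : ∀ k t, 0 ≤ deriv (H k) t := fun k t => by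
    rw [hder]
    positivity
  have hder1 : ∀ k t, ‖deriv (H k) t‖ ≤ k := fun k t => by
    rw [Real.norm_of_nonneg (hder0 k t), hder]
    refine mul_le_of_le_one_left (by positivity) ?_
    rw [div_le_one (by positivity)]
    nlinarith [sq_nonneg ((k : ℝ) * t)]
  have hle : ∀ k, ∫ x in Ω, H k (u x) * inner ℝ (‖G x‖ ^ (p - 2) • G x) (gradient φ x) ≤
      lam * ∫ x in Ω, H k (u x) * (φ x * (‖u x‖ ^ (p - 2) • u x)) := fun k => by
    rw [← h.integral_comp_eq hp hφ (hH k) (C := Real.pi / 2 + k) (by simp [H])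
      (fun t => (hb k t).trans (by simp))
      (fun t => (hder1 k t).trans (by linarith [Real.pi_pos]))]
    -- The dropped term is `∫ H'(u) φ ‖G‖^p`, nonnegative as `H` is monotone and `φ ≥ 0` on `Ω`.
    refine le_add_of_nonneg_right (integral_nonneg_of_ae ?_)
    filter_upwards [ae_restrict_mem hΩ.measurableSet] with x hx
    exact mul_nonneg (hder0 k _) (mul_nonneg (hφ0 x hx) (by positivity))
  have hlim : ∀ᵐ x ∂(volume.restrict Ω),
      Tendsto (fun k => H k (u x)) atTop (𝓝 (Real.pi / 2)) := by
    filter_upwards [hpos] with x hx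
    exact (Real.tendsto_arctan_atTop.mono_right nhdsWithin_le_nhds).comp
      (tendsto_natCast_atTop_atTop.atTop_mul_const hx)
  have hm : ∀ k, AEStronglyMeasurable (fun x => H k (u x)) (volume.restrict Ω) := fun k =>
    (hH k).continuous.comp_aestronglyMeasurable h.mem.memLp.1
  have h1 := tendsto_integral_mul_of_bounded
    (integrable_inner_of_memLp hF (hφ.memLp_gradient (ENNReal.ofReal p) (volume.restrict Ω)))
    hm (fun k x => hb k _) hlim
  have h2 := tendsto_integral_mul_of_bounded
    (w := fun x => φ x * (‖u x‖ ^ (p - 2) • u x))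
    (by simpa only [RCLike.inner_apply, conj_trivial] using integrable_inner_of_memLp hf hφp)
    hm (fun k x => hb k _) hlim
  have h3 := le_of_tendsto_of_tendsto' h1 (h2.const_mul lam) hle
  rw [integral_const_mul, integral_const_mul, mul_left_comm] at h3
  exact le_of_mul_le_mul_left h3 (by positivity)

end IsEigenfunction

end PLaplace

end

/-! ### Weak duality and the optimal dual field -/

section

namespace PLaplace

variable {N : ℕ} {Ω : Set (Euc N)} {p : ℝ}

/-- Young's inequality with the weights of the primal and dual energies. -/
theorem inner_le_young_weighted {E : Type*} [NormedAddCommGroup E] [InnerProductSpace ℝ E]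
    {lam : ℝ} (hp : 1 < p) (hlam : 0 < lam) (s g : E) :
    inner ℝ s g ≤ 1 / (p * lam) * ‖g‖ ^ p +
      1 / (p / (p - 1)) * lam ^ (p / (p - 1) - 1) * ‖s‖ ^ (p / (p - 1)) := by
  have hp1 : p - 1 ≠ 0 := by linarith
  have hp0 : p ≠ 0 := by linarith
  have hl := hlam.le
  -- The weights `lam^(∓1/p)` cancel in the product, and their powers `p` and `p'` are `lam⁻¹` and
  -- `lam^(p'-1)`.
  have hy := Real.young_inequality_of_nonneg (a := lam ^ (-(1 / p)) * ‖g‖)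
    (b := lam ^ (1 / p) * ‖s‖) (by positivity) (by positivity)
    (Real.HolderConjugate.conjExponent hp)
  rw [Real.conjExponent, Real.mul_rpow (by positivity) (norm_nonneg g),
    Real.mul_rpow (by positivity) (norm_nonneg s), ← Real.rpow_mul hl, ← Real.rpow_mul hl,
    show -(1 / p) * p = -1 by field_simp,
    show 1 / p * (p / (p - 1)) = p / (p - 1) - 1 by field_simp; ring, Real.rpow_neg_one] at hy
  have h1 : lam ^ (-(1 / p)) * lam ^ (1 / p) = 1 := by
    rw [← Real.rpow_add hlam, neg_add_cancel, Real.rpow_zero]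
  calc inner ℝ s g ≤ ‖s‖ * ‖g‖ := real_inner_le_norm s g
    _ = lam ^ (-(1 / p)) * ‖g‖ * (lam ^ (1 / p) * ‖s‖) := by
      linear_combination (-(‖s‖ * ‖g‖)) * h1
    _ ≤ _ := hy
    _ = _ := by
      rw [one_div_mul_eq_div, div_eq_mul_one_div (lam⁻¹ * _)]
      field_simp

/-- By density `∫ f v = ∫_Ω σ · G`, and Young's inequality applies pointwise. Passing from `Ω` to
`closure Ω` only enlarges the dual energy, so a boundary of positive volume is harmless. -/
theorem neg_dual_le_primal {lam : ℝ} (hp : 1 < p) (hlam : 0 < lam)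
    {f v : Euc N → ℝ} {G σ : Euc N → Euc N}
    (hf : MemLp f (ENNReal.ofReal (p / (p - 1))) (volume.restrict Ω)) (hv : MemWZero Ω p v G)
    (hσ : IsAdmissible Ω (p / (p - 1)) f σ) :
    -(1 / (p / (p - 1)) * lam ^ (p / (p - 1) - 1) * ∫ x in closure Ω, ‖σ x‖ ^ (p / (p - 1))) ≤
      1 / (p * lam) * (∫ x in Ω, ‖G x‖ ^ p) - ∫ x in Ω, f x * v x := by
  have := holderConjugate_conj hp
  have hq : 0 < p / (p - 1) := div_pos (by linarith) (by linarith)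
  have hσΩ : MemLp σ (ENNReal.ofReal (p / (p - 1))) (volume.restrict Ω) := hσ.memLp.restrict Ω
  have hpair := hv.integral_inner_eq hp hσΩ hf (fun φ hφ => by
    rw [setIntegral_eq_integral_of_forall_compl_eq_zero (fun x hx => by
      rw [hφ.gradient_eq_zero_of_notMem hx, inner_zero_right])]
    simpa only [real_inner_comm, mul_comm] using hσ.divEq φ hφ)
  have hiG := integrable_norm_rpow_of_memLp (by linarith) hv.memLp_grad
  have hiσ := integrable_norm_rpow_of_memLp hq hσ.memLp
  have hle : ∫ x in Ω, ‖σ x‖ ^ (p / (p - 1)) ≤ ∫ x in closure Ω, ‖σ x‖ ^ (p / (p - 1)) :=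
    setIntegral_mono_set hiσ.integrableOn (.of_forall fun x => by positivity)
      subset_closure.eventuallyLE
  have hc : 0 ≤ 1 / (p / (p - 1)) * lam ^ (p / (p - 1) - 1) := by positivity
  have hmono := integral_mono (μ := volume.restrict Ω)
    (integrable_inner_of_memLp hσΩ hv.memLp_grad)
    ((hiG.const_mul (1 / (p * lam))).add
      (hiσ.integrableOn.const_mul (1 / (p / (p - 1)) * lam ^ (p / (p - 1) - 1))))
    (fun x => inner_le_young_weighted hp hlam (σ x) (G x))
  rw [integral_add' (hiG.const_mul _) (hiσ.integrableOn.const_mul _), integral_const_mul,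
    integral_const_mul, hpair] at hmono
  linarith [mul_le_mul_of_nonneg_left hle hc]

/-- The normalized flux of `u`, extended by zero outside `Ω`. -/
noncomputable def dualField (Ω : Set (Euc N)) (p lam : ℝ) (G : Euc N → Euc N) : Euc N → Euc N :=
  Ω.indicator fun x => lam⁻¹ • ‖G x‖ ^ (p - 2) • G x

theorem integral_inner_dualField (hΩ : IsOpen Ω) (lam : ℝ) (φ : Euc N → ℝ) (G : Euc N → Euc N) :
    ∫ x, inner ℝ (gradient φ x) (dualField Ω p lam G x) =
      lam⁻¹ * ∫ x in Ω, inner ℝ (‖G x‖ ^ (p - 2) • G x) (gradient φ x) := by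
  rw [← integral_const_mul, ← integral_indicator hΩ.measurableSet]
  refine integral_congr_ae (.of_forall fun x => ?_)
  by_cases hx : x ∈ Ω
  · simp only [dualField, Set.indicator_of_mem hx, real_inner_smul_right, real_inner_comm]
  · simp only [dualField, Set.indicator_of_notMem hx, inner_zero_right]

theorem integral_norm_dualField (hΩ : IsOpen Ω) (hp : 1 < p) {lam : ℝ} (hlam : 0 < lam)
    (G : Euc N → Euc N) :
    ∫ x in closure Ω, ‖dualField Ω p lam G x‖ ^ (p / (p - 1)) =
      lam⁻¹ ^ (p / (p - 1)) * ∫ x in Ω, ‖G x‖ ^ p := by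
  have hq : p / (p - 1) ≠ 0 := (div_pos (by linarith) (by linarith)).ne'
  rw [← integral_const_mul]
  trans ∫ x in closure Ω, Ω.indicator (fun x => lam⁻¹ ^ (p / (p - 1)) * ‖G x‖ ^ p) x
  · refine integral_congr_ae (.of_forall fun x => ?_)
    by_cases hx : x ∈ Ω
    · simp only [dualField, Set.indicator_of_mem hx]
      rw [norm_smul, Real.mul_rpow (norm_nonneg _) (norm_nonneg _), norm_flux_rpow hp,
        Real.norm_of_nonneg (by positivity)]
    · simp [dualField, Set.indicator_of_notMem hx, Real.zero_rpow hq]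
  · rw [setIntegral_indicator hΩ.measurableSet,
      Set.inter_eq_self_of_subset_right subset_closure]

theorem IsEigenfunction.isAdmissible_dualField {lam : ℝ} {u f : Euc N → ℝ} {G : Euc N → Euc N}
    (hΩ : IsOpen Ω) (hbdd : Bornology.IsBounded Ω) (hp : 1 < p) (hlam : 0 < lam)
    (h : IsEigenfunction Ω p lam u G) (hpos : ∀ᵐ x ∂(volume.restrict Ω), 0 < u x)
    (hf : f =ᵐ[volume.restrict Ω] fun x => ‖u x‖ ^ (p - 2) • u x) :
    IsAdmissible Ω (p / (p - 1)) f (dualField Ω p lam G) := by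
  have := holderConjugate_conj hp
  have hF := memLp_flux hp h.mem.memLp_grad
  have hfq := (memLp_congr_ae hf).2 (memLp_flux hp h.mem.memLp)
  have hfin : IsFiniteMeasure (volume.restrict Ω) := ⟨by simpa using hbdd.measure_lt_top⟩
  have hq1 : 1 ≤ p / (p - 1) := by
    rw [le_div_iff₀ (by linarith)]
    linarith
  have hfi : Integrable f (volume.restrict Ω) := hfq.integrable (by simpa using hq1)
  have hfφ : ∀ φ : Euc N → ℝ, ∫ x in Ω, φ x * (‖u x‖ ^ (p - 2) • u x) = ∫ x in Ω, φ x * f x :=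
    fun φ => integral_congr_ae (hf.mono fun x hx => by simp only [hx])
  have hiF : ∀ φ, IsTest Set.univ φ → Integrable
      (fun x => inner ℝ (‖G x‖ ^ (p - 2) • G x) (gradient φ x)) (volume.restrict Ω) :=
    fun φ hφ => integrable_inner_of_memLp hF (hφ.memLp_gradient (ENNReal.ofReal p) _)
  have hif : ∀ φ, IsTest Set.univ φ → Integrable (fun x => φ x * f x) (volume.restrict Ω) :=
    fun φ hφ => by
      obtain ⟨C, hC⟩ := hφ.exists_bound
      exact hfi.bdd_mul hφ.smooth.continuous.aestronglyMeasurable (.of_forall hC)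
  refine ⟨?_, .of_forall fun x hx => Set.indicator_of_notMem (fun hx' => hx (subset_closure hx')) _,
    ?_, fun φ hφ => ?_⟩
  · exact (memLp_indicator_iff_restrict hΩ.measurableSet).2 (hF.const_smul lam⁻¹)
  -- The functional is `f + div σ`, nonnegative by the subsolution inequality; thus `-div σ` is `f
  -- dx - ν`.
  · obtain ⟨ν, hν, hνT⟩ := exists_finite_measure_of_nonneg hbdd
      (fun φ => (∫ x in Ω, φ x * f x) -
        lam⁻¹ * ∫ x in Ω, inner ℝ (‖G x‖ ^ (p - 2) • G x) (gradient φ x))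
      (fun φ ψ hφ hψ => by
        simp only [gradient_add_of_differentiable hφ.differentiable hψ.differentiable,
          inner_add_right, Pi.add_apply, add_mul]
        rw [integral_add (hif φ hφ) (hif ψ hψ), integral_add (hiF φ hφ) (hiF ψ hψ)]
        ring)
      (fun c φ hφ => by
        simp only [gradient_smul_of_differentiable c hφ.differentiable, real_inner_smul_right,
          Pi.smul_apply, smul_eq_mul, mul_assoc]
        rw [integral_const_mul, integral_const_mul]
        ring)
      (fun φ hφ hφ0 => by
        have hle := h.integral_inner_flux_le hp hΩ hpos hφ hφ0
        rw [hfφ] at hle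
        rw [sub_nonneg, inv_mul_le_iff₀ hlam]
        exact hle)
    have hf0 : ∀ᵐ x ∂(volume.restrict Ω), 0 ≤ f x := by
      filter_upwards [hf, hpos] with x hx hx0
      rw [hx]
      exact smul_nonneg (by positivity) hx0.le
    refine ⟨(volume.restrict Ω).withDensity fun x => ENNReal.ofReal (f x), ν,
      isFiniteMeasure_withDensity_ofReal hfi.2, hν, fun φ hφ => ?_⟩
    rw [hνT φ hφ, integral_inner_dualField hΩ,
      integral_withDensity_eq_integral_toReal_smul₀ hfi.1.aemeasurable.ennreal_ofReal
        (.of_forall fun x => ENNReal.ofReal_lt_top)]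
    have : ∫ x in Ω, (ENNReal.ofReal (f x)).toReal • φ x = ∫ x in Ω, φ x * f x := by
      refine integral_congr_ae (hf0.mono fun x hx => ?_)
      simp only [ENNReal.toReal_ofReal hx, smul_eq_mul, mul_comm]
    rw [this]
    ring
  · have hw := h.weakEq φ hφ
    rw [integral_inner_dualField hΩ, inv_mul_eq_iff_eq_mul₀ hlam.ne', ← hfφ]
    simpa only [real_inner_smul_left, Real.norm_eq_abs, smul_eq_mul, mul_comm] using hw

end PLaplace

end

/-! ### Conclusion: the two candidates have opposite energies -/

theorem mainTheorem10 (N : ℕ) (hN : 1 ≤ N) (Ω : Set (PLaplace.Euc N)) (hΩ : IsOpen Ω)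
    (hbdd : Bornology.IsBounded Ω) (p : ℝ) (hp : 1 < p)
    (u : PLaplace.Euc N → ℝ) (hu : PLaplace.IsFirstEigenfunction Ω p u) :
    ∃ m : ℝ, IsLeast (PLaplace.primalValues Ω p (fun x => u x ^ (p - 1))) m ∧
      IsLeast (PLaplace.dualValues Ω p (fun x => u x ^ (p - 1))) (-m) := by
  obtain ⟨⟨G, hG⟩, hpos, hnorm⟩ := hu
  have hlam := hG.eigenvalue_pos hN hΩ hbdd hp hpos hnorm
  set lam := PLaplace.firstEigenvalue Ω p
  have hp0 : p ≠ 0 := by linarith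
  have hp1 : p - 1 ≠ 0 := by linarith
  have hf : (fun x => u x ^ (p - 1)) =ᵐ[volume.restrict Ω] fun x => ‖u x‖ ^ (p - 2) • u x := by
    filter_upwards [hpos] with x hx
    rw [Real.norm_of_nonneg hx.le, smul_eq_mul, PLaplace.rpow_sub_two_mul_self hp hx.le]
  have hfq := (memLp_congr_ae hf).2 (PLaplace.memLp_flux hp hG.mem.memLp)
  have habs : ∫ x in Ω, |u x| ^ p = 1 := by
    rw [← hnorm]
    exact integral_congr_ae (hpos.mono fun x hx => by simp only [abs_of_pos hx])
  have henergy : ∫ x in Ω, ‖G x‖ ^ p = lam := by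
    rw [hG.integral_norm_rpow hp, habs, mul_one]
  have hfu : ∫ x in Ω, u x ^ (p - 1) * u x = 1 :=
    (integral_congr_ae (hpos.mono fun x hx =>
      PLaplace.rpow_sub_one_mul_self hp hx.le)).trans hnorm
  have hadm := hG.isAdmissible_dualField hΩ hbdd hp hlam hpos hf
  have hprimal : 1 / p - 1 = 1 / (p * lam) * (∫ x in Ω, ‖G x‖ ^ p) -
      ∫ x in Ω, u x ^ (p - 1) * u x := by
    rw [henergy, hfu]
    field_simp
  -- The powers `lam^(p'-1)`, `lam^(-p')` and the energy `lam` multiply to one, leaving `1/p'`.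
  have hdual : -(1 / p - 1) = 1 / (p / (p - 1)) * lam ^ (p / (p - 1) - 1) *
      ∫ x in closure Ω, ‖PLaplace.dualField Ω p lam G x‖ ^ (p / (p - 1)) := by
    rw [PLaplace.integral_norm_dualField hΩ hp hlam, henergy, Real.inv_rpow hlam.le,
      Real.rpow_sub_one hlam.ne']
    have := (Real.rpow_pos_of_pos hlam (p / (p - 1))).ne'
    field_simp
    ring
  refine ⟨1 / p - 1, ⟨⟨u, G, hG.mem, hprimal⟩, ?_⟩, ⟨⟨_, hadm, hdual⟩, ?_⟩⟩
  · rintro t ⟨v, Gv, hv, rfl⟩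
    have := PLaplace.neg_dual_le_primal hp hlam hfq hv hadm
    linarith
  · rintro t ⟨σ, hσ, rfl⟩
    have := PLaplace.neg_dual_le_primal hp hlam hfq hG.mem hσ
    linarith
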